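/- Let $\mathcal H$ and $\mathcal G$ be complex Hilbert spaces (not necessarily separable), with inner products linear in the first argument. A linear relation in a Hilbert space $\mathcal K$ is a linear subspace $S\subset\mathcal K\times\mathcal K$ (operators are identified with their graphs); its adjoint is $S^*=\{(g,g') : (f',g)=(f,g')\text{ for all }(f,f')\in S\}$, and $S$ is symmetric (self-adjoint) if $S\subset S^*$ ($S=S^*$). Write $\operatorname{dom}S$ and $\operatorname{ran}S$ for the sets of first and second components of elements of $S$, and $S^{-1}(X)=\{x : \exists\, y\in X,\ (x,y)\in S\}$ for a subspace $X$. For a self-adjoint relation $S$ in $\mathcal K$ let $S_{\rm op}=S\cap(\mathcal K_{\rm op}\times\mathcal K_{\rm op})$ be its operator part, a self-adjoint operator in $\mathcal K_{\rm op}=\overline{\operatorname{dom}S}$; a point $\lambda\in\mathbb R$ belongs to $\sigma_{\rm ess}(S)$ if $S_{\rm op}-\lambda$ is not a Fredholm operator in $\mathcal K_{\rm op}$ (Fredholm: finite-dimensional kernel, and closed range of finite codimension). Let $A$ be a closed symmetric relation in $\mathcal H$ and let $\{\mathcal G,\Gamma_0,\Gamma_1\}$ be a quasi boundary triple for $A^*$,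 that is, $\Gamma_0,\Gamma_1$ are linear mappings from a dense subspace $T$ of $A^*$ to $\mathcal G$ such that $\Gamma=(\Gamma_0,\Gamma_1):T\to\mathcal G\times\mathcal G$ has dense range, $A_0=\ker\Gamma_0$ is self-adjoint in $\mathcal H$, and $$(f',g)-(f,g')=(\Gamma_1\hat f,\Gamma_0\hat g)-(\Gamma_0\hat f,\Gamma_1\hat g)\qquad\text{for all }\hat f=(f,f'),\ \hat g=(g,g')\in T.$$ Let $A_1=\ker\Gamma_1$, $\mathcal G_0=\operatorname{ran}\Gamma_0$, and for $\lambda\in\mathbb C\setminus\mathbb R$ let $M(\lambda)$ be the value of the associated Weyl function, i.e. the operator with domain $\mathcal G_0$ given by $M(\lambda)\Gamma_0\hat f=\Gamma_1\hat f$ for all $\hat f\in T$ of the form $\hat f=(f,\lambda f)$; $\overline{M(\lambda)}$ denotes its closure in $\mathcal G$. **Theorem.** Assume that $A_1$ is self-adjoint and that $\overline{M(\lambda_0)}$ is an everywhere defined compact operator in $\mathcal G$ for some $\lambda_0\in\mathbb C\setminus\mathbb R$. If $\Theta$ is a self-adjoint relation in $\mathcal G$ such that $$0\notin\sigma_{\rm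 ess}(\Theta)\qquad\text{and}\qquad \Theta^{-1}\bigl(\operatorname{ran}\overline{M(\lambda_\pm)}\bigr)\subset\mathcal G_0$$ hold for some $\lambda_+$ with $\operatorname{Im}\lambda_+>0$ and some $\lambda_-$ with $\operatorname{Im}\lambda_-<0$, then $A_\Theta=\{\hat f\in T : \Gamma\hat f\in\Theta\}$ is self-adjoint in $\mathcal H$. In particular, for a self-adjoint relation $\Theta$ in $\mathcal G$ with $\operatorname{dom}\Theta\subset\mathcal G_0$, the second condition is satisfied (for all such $\lambda_\pm$). -/

import Mathlib

/-! Linear relations from `E` to `F` are linear subspaces of `E × F`; operators are identified with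
their graphs. The adjoint of a relation is Mathlib's `Submodule.adjoint`:
`(g, g') ∈ S.adjoint ↔ ∀ (f, f') ∈ S, ⟪f', g⟫ = ⟪f, g'⟫`. -/

namespace LinRel

section Basic

variable {E F : Type*} [AddCommGroup E] [Module ℂ E] [AddCommGroup F] [Module ℂ F]

/-- The domain of a linear relation. -/
def dom (S : Submodule ℂ (E × F)) : Submodule ℂ E := S.map (LinearMap.fst ℂ E F)

/-- The range of a linear relation. -/
def ran (S : Submodule ℂ (E × F)) : Submodule ℂ F := S.map (LinearMap.snd ℂ E F)

/-- The kernel `{f | (f, 0) ∈ S}` of a linear relation. -/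
def ker (S : Submodule ℂ (E × F)) : Submodule ℂ E := S.comap (LinearMap.inl ℂ E F)

/-- `S⁻¹(X) = {x | ∃ y ∈ X, (x, y) ∈ S}`. -/
def preimage (S : Submodule ℂ (E × F)) (X : Set F) : Set E := {x | ∃ y ∈ X, (x, y) ∈ S}

/-- The relation `S - z = {(f, f' - z f) | (f, f') ∈ S}`. -/
def subScalar (S : Submodule ℂ (E × E)) (z : ℂ) : Submodule ℂ (E × E) :=
  S.map ((LinearMap.fst ℂ E E).prod (LinearMap.snd ℂ E E - z • LinearMap.fst ℂ E E))

end Basic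

section Hilbert

variable {E F : Type*} [NormedAddCommGroup E] [InnerProductSpace ℂ E]
  [NormedAddCommGroup F] [InnerProductSpace ℂ F]

/-- A symmetric relation: `S ⊆ S*`. -/
def IsSymmetric (S : Submodule ℂ (E × E)) : Prop := S ≤ S.adjoint

/-- A self-adjoint relation: `S = S*`. -/
def IsSelfAdjoint (S : Submodule ℂ (E × E)) : Prop := S = S.adjoint

/-- The Fredholm property of a (closed, possibly unbounded) operator, given by its graph:
finite-dimensional kernel, and closed range of finite codimension. -/
structure IsFredholm (S : Submodule ℂ (E × F)) : Prop where
  finiteDimensional_ker : FiniteDimensional ℂ (ker S)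
  isClosed_ran : IsClosed (ran S : Set F)
  finiteDimensional_coker : FiniteDimensional ℂ (F ⧸ ran S)

/-- The essential spectrum of a closed operator, given by its graph `S`. -/
def essSpectrumOp (S : Submodule ℂ (E × E)) : Set ℂ := {z | ¬ IsFredholm (subScalar S z)}

/-- The space `E_op`, the closure of `dom S`. -/
abbrev opSpace (S : Submodule ℂ (E × E)) : Submodule ℂ E := (dom S).topologicalClosure

/-- The operator part `S_op = S ∩ (E_op × E_op)` of a self-adjoint relation `S`, regarded as
(the graph of) an operator in the Hilbert space `E_op`. -/
def opPart (S : Submodule ℂ (E × E)) : Submodule ℂ (opSpace S × opSpace S) :=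
  S.comap ((opSpace S).subtype.prodMap (opSpace S).subtype)

/-- The essential spectrum of a self-adjoint relation: the real points in the essential spectrum
of its operator part. -/
def essSpectrum (S : Submodule ℂ (E × E)) : Set ℝ := {t | (t : ℂ) ∈ essSpectrumOp (opPart S)}

/-- `S`, viewed as a relation, is (the graph of) an everywhere defined compact operator. -/
def IsCompactOp (S : Submodule ℂ (E × F)) : Prop :=
  ∃ K : E →L[ℂ] F, IsCompactOperator K ∧ S = LinearMap.graph (K : E →ₗ[ℂ] F)

end Hilbert

end LinRel

/-- A quasi boundary triple `{G, Γ₀, Γ₁}` for `A*`. -/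
structure QuasiBoundaryTriple {H : Type*} [NormedAddCommGroup H] [InnerProductSpace ℂ H]
    (A : Submodule ℂ (H × H)) (G : Type*) [NormedAddCommGroup G] [InnerProductSpace ℂ G] where
  /-- the common domain of the boundary mappings, a dense subspace of `A*` -/
  T : Submodule ℂ (H × H)
  Γ₀ : T →ₗ[ℂ] G
  Γ₁ : T →ₗ[ℂ] G
  le_adjoint : T ≤ A.adjoint
  dense_T : A.adjoint ≤ T.topologicalClosure
  dense_range : DenseRange (Γ₀.prod Γ₁)
  isSelfAdjoint_ker : LinRel.IsSelfAdjoint ((LinearMap.ker Γ₀).map T.subtype)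
  /-- The abstract Green identity `(f', g) - (f, g') = (Γ₁ f̂, Γ₀ ĝ) - (Γ₀ f̂, Γ₁ ĝ)`, where
  `(x, y)`, linear in `x`, is `inner ℂ y x`. -/
  green : ∀ f g : T,
    inner ℂ (g : H × H).1 (f : H × H).2 - inner ℂ (g : H × H).2 (f : H × H).1 =
      inner ℂ (Γ₀ g) (Γ₁ f) - inner ℂ (Γ₁ g) (Γ₀ f)

namespace QuasiBoundaryTriple

variable {H : Type*} [NormedAddCommGroup H] [InnerProductSpace ℂ H] {A : Submodule ℂ (H × H)}
  {G : Type*} [NormedAddCommGroup G] [InnerProductSpace ℂ G]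

/-- The relation `A₁ = ker Γ₁` in `H`. -/
def A₁ (Q : QuasiBoundaryTriple A G) : Submodule ℂ (H × H) :=
  (LinearMap.ker Q.Γ₁).map Q.T.subtype

/-- `𝒢₀ = ran Γ₀`. -/
def G₀ (Q : QuasiBoundaryTriple A G) : Submodule ℂ G := LinearMap.range Q.Γ₀

/-- The extension `A_Θ = {f̂ ∈ T | (Γ₀ f̂, Γ₁ f̂) ∈ Θ}`. -/
def ext (Q : QuasiBoundaryTriple A G) (Θ : Submodule ℂ (G × G)) : Submodule ℂ (H × H) :=
  (Θ.comap (Q.Γ₀.prod Q.Γ₁)).map Q.T.subtype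

/-- `N̂_z = {(f, z f) | (f, z f) ∈ T}`, as a subspace of `T`. -/
def defect (Q : QuasiBoundaryTriple A G) (z : ℂ) : Submodule ℂ Q.T :=
  (LinearMap.graph (z • (LinearMap.id : H →ₗ[ℂ] H))).comap Q.T.subtype

/-- The Weyl function `M(z) = Γ₁ (Γ₀ ↾ N̂_z)⁻¹`, as a relation in `G`:
`M(z) = {(Γ₀ f̂, Γ₁ f̂) | f̂ ∈ N̂_z}`. For `z` in the resolvent set of `ker Γ₀`, in particular for
non-real `z`, it is the graph of an operator with domain `ran Γ₀`. -/
def weyl (Q : QuasiBoundaryTriple A G) (z : ℂ) : Submodule ℂ (G × G) :=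
  (Q.defect z).map (Q.Γ₀.prod Q.Γ₁)

end QuasiBoundaryTriple

/-!
By Green's identity `A_Θ` is symmetric, so it suffices that `A_Θ - λ` is onto for one `λ` in each
open half-plane (`LinRel.IsSymmetric.isSelfAdjoint`; the two points need not be conjugate).

Fix a non-real `λ` and `h`. As `A₀ = ker Γ₀` is self-adjoint, there is `f̂ ∈ A₀` with
`f' - λ f = h`, and adding `n ∈ N̂_λ` does not change `h`. The sum `f̂ + n` lies in `A_Θ` exactly
when `φ = Γ₀ n` satisfies `(φ, Γ₁ f̂ + M(λ) φ) ∈ Θ`, which is an equation for `Θ - M(λ)`. Two things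
are needed to solve it.

* `M(λ)` has a compact everywhere defined extension for every non-real `λ`, not only for `λ₀`
  (`QuasiBoundaryTriple.exists_isCompactOperator_weyl`). The `γ`-field is bounded by the closed
  graph theorem, compactness of `γ(λ₀)` follows from that of
  `M(λ₀) - M(λ₀)* = (λ₀ - λ̄₀) γ(λ₀)* γ(λ₀)`, and then
  `M(λ) ⊆ M(λ₀)* + (λ - λ̄₀) γ(λ₀)* γ(λ)` is compact. The adjoints are those of the closure of
  `M(λ₀)`.
* The Fredholm alternative holds for `Θ - K` with `K` compact
  (`LinRel.IsSelfAdjoint.exists_add_mem_of_isCompactOperator`). If `0 ∉ σ_ess(Θ)` and `P` is the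
  projection onto the finite-dimensional kernel of `Θ`, then `Θ + P` has a bounded inverse `R`, and
  the equation becomes one for `1 - R (K + P)`.

The condition on `Θ⁻¹ (ran M(λ))` brings the solutions back into `𝒢₀ = ran Γ₀`, where they
correspond to elements of `N̂_λ`: for the homogeneous equation this gives a vector of the symmetric
relation `A_Θ` in `N̂_λ`, hence `0`; for the inhomogeneous one it applies because `Γ₁ f̂ ∈ ran M(λ)`,
by self-adjointness of `A₁ = ker Γ₁`.
-/

namespace LinRel

/-! ### Closed graphs and compact adjoints -/

section ClosedGraph

variable {E F : Type*} [NormedAddCommGroup E] [NormedSpace ℂ E] [CompleteSpace E]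
  [NormedAddCommGroup F] [NormedSpace ℂ F] [CompleteSpace F]

/-- The closed graph theorem for linear relations. -/
lemma exists_clm_of_isClosed {W : Submodule ℂ (E × F)} (hW : IsClosed (W : Set (E × F)))
    (h : ∀ x, ∃! y, (x, y) ∈ W) : ∃ L : E →L[ℂ] F, ∀ x y, (x, y) ∈ W ↔ y = L x := by
  choose L hL hu using h
  let L' : E →ₗ[ℂ] F :=
    { toFun := L
      map_add' := fun x y => (hu _ _ (W.add_mem (hL x) (hL y))).symm
      map_smul' := fun c x => (hu _ _ (W.smul_mem c (hL x))).symm }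
  have hgr : L'.graph = W := by
    ext ⟨x, y⟩
    rw [LinearMap.mem_graph_iff]
    exact ⟨fun hy => by rw [show y = L x from hy]; exact hL x, fun hy => hu x y hy⟩
  refine ⟨ContinuousLinearMap.ofIsClosedGraph (g := L') (by rwa [hgr]), fun x y => ?_⟩
  have hxy : (x, y) ∈ L'.graph ↔ y = L' x := by rw [LinearMap.mem_graph_iff]
  rwa [hgr] at hxy

end ClosedGraph

section Compact

variable {E F : Type*} [NormedAddCommGroup E] [InnerProductSpace ℂ E] [CompleteSpace E]
  [NormedAddCommGroup F] [InnerProductSpace ℂ F] [CompleteSpace F]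

/-- If `T* T` is compact, then so is `T`, because `‖T x‖² ≤ ‖T* T x‖ ‖x‖`. -/
lemma isCompactOperator_of_adjoint_comp {T : E →L[ℂ] F}
    (h : IsCompactOperator (T.adjoint ∘L T)) : IsCompactOperator T := by
  refine (isCompactOperator_iff_isCompact_closure_image_ball (T : E →ₗ[ℂ] F) one_pos).2 ?_
  have htb : TotallyBounded ((T.adjoint ∘L T) '' Metric.ball 0 1) :=
    (IsCompactOperator.isCompact_closure_image_ball
      (f := ((T.adjoint ∘L T : E →L[ℂ] E) : E →ₗ[ℂ] E)) h 1).totallyBounded.subset subset_closure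
  refine TotallyBounded.isCompact_of_isClosed (TotallyBounded.closure ?_) isClosed_closure
  refine Metric.totallyBounded_iff.2 fun ε hε => ?_
  -- differences in the unit ball have norm at most `2`, so a net of mesh `ε² / 2` for `T* T`
  -- gives one of mesh `ε` for `T`
  obtain ⟨t, hts, htf, hcov⟩ :=
    Metric.finite_approx_of_totallyBounded htb (ε ^ 2 / 2) (by positivity)
  choose! c hc hcx using fun y (hy : y ∈ t) => hts hy
  refine ⟨(fun y => T (c y)) '' t, htf.image _, ?_⟩
  rintro _ ⟨x, hx, rfl⟩
  obtain ⟨y, hy, hxy⟩ := Set.mem_iUnion₂.1 (hcov ⟨x, hx, rfl⟩)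
  refine Set.mem_iUnion₂.2 ⟨T (c y), ⟨y, hy, rfl⟩, ?_⟩
  rw [mem_ball_iff_norm] at hxy ⊢
  have hcy := hc y hy
  rw [← hcx y hy, ← map_sub] at hxy
  rw [mem_ball_zero_iff] at hx hcy
  have h2 : ‖x - c y‖ ≤ 2 := (norm_sub_le _ _).trans (by linarith)
  have h1 : ‖T (x - c y)‖ ^ 2 < ε ^ 2 := by
    calc ‖T (x - c y)‖ ^ 2 = RCLike.re (inner ℂ ((T.adjoint ∘L T) (x - c y)) (x - c y)) :=
          T.apply_norm_sq_eq_inner_adjoint_left _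
      _ ≤ ‖(T.adjoint ∘L T) (x - c y)‖ * ‖x - c y‖ := re_inner_le_norm _ _
      _ ≤ ‖(T.adjoint ∘L T) (x - c y)‖ * 2 := by gcongr
      _ < ε ^ 2 := by linarith
  change ‖T x - T (c y)‖ < ε
  rw [← map_sub]
  exact lt_of_pow_lt_pow_left₀ 2 hε.le h1

lemma isCompactOperator_adjoint {T : E →L[ℂ] F} (h : IsCompactOperator T) :
    IsCompactOperator T.adjoint := by
  refine isCompactOperator_of_adjoint_comp ?_
  rw [ContinuousLinearMap.adjoint_adjoint]
  exact h.comp_clm T.adjoint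

end Compact

/-! ### Symmetric and self-adjoint relations -/

section SelfAdjoint

variable {E : Type*} [NormedAddCommGroup E] [InnerProductSpace ℂ E]

lemma im_inner_smul_self (z : ℂ) (x : E) : (inner ℂ x (z • x) : ℂ).im = z.im * ‖x‖ ^ 2 := by
  have h : inner ℂ x x = ((‖x‖ ^ 2 : ℝ) : ℂ) := by
    rw [inner_self_eq_norm_sq_to_K]; push_cast; rfl
  rw [inner_smul_right, h, Complex.im_mul_ofReal]

lemma IsSymmetric.inner_eq {S : Submodule ℂ (E × E)} (hS : IsSymmetric S) {x y : E × E}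
    (hx : x ∈ S) (hy : y ∈ S) : inner ℂ x.2 y.1 = inner ℂ x.1 y.2 :=
  sub_eq_zero.1 ((Submodule.mem_adjoint_iff _ _).1 (hS hy) x.1 x.2 hx)

lemma IsSelfAdjoint.isSymmetric {S : Submodule ℂ (E × E)} (hS : IsSelfAdjoint S) :
    IsSymmetric S := le_of_eq hS

lemma IsSelfAdjoint.mem_of_inner_eq {S : Submodule ℂ (E × E)} (hS : IsSelfAdjoint S) {f f' : E}
    (h : ∀ a b, (a, b) ∈ S → inner ℂ b f = inner ℂ a f') : (f, f') ∈ S := by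
  rw [hS, Submodule.mem_adjoint_iff]
  exact fun a b hab => sub_eq_zero.2 (h a b hab)

lemma IsSelfAdjoint.isClosed {S : Submodule ℂ (E × E)} (hS : IsSelfAdjoint S) :
    IsClosed (S : Set (E × E)) := by
  have : (S : Set (E × E)) =
      ⋂ x ∈ S, {y : E × E | inner ℂ x.2 y.1 - inner ℂ x.1 y.2 = 0} := by
    ext y
    rw [SetLike.mem_coe, hS, Submodule.mem_adjoint_iff, ← hS]
    simp
  rw [this]
  exact isClosed_biInter fun x _ => isClosed_eq (by fun_prop) continuous_const

lemma IsSymmetric.abs_im_mul_norm_le {S : Submodule ℂ (E × E)} (hS : IsSymmetric S) (z : ℂ)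
    {x : E × E} (hx : x ∈ S) : |z.im| * ‖x.1‖ ≤ ‖x.2 - z • x.1‖ := by
  have h1 : (inner ℂ x.1 x.2 : ℂ).im = 0 := by
    have h := hS.inner_eq hx hx
    rw [← inner_conj_symm] at h
    exact Complex.conj_eq_iff_im.1 h
  have h2 : (inner ℂ x.1 (x.2 - z • x.1) : ℂ).im = -(z.im * ‖x.1‖ ^ 2) := by
    rw [inner_sub_right, Complex.sub_im, im_inner_smul_self, h1, zero_sub]
  have h3 : |z.im| * ‖x.1‖ ^ 2 ≤ ‖x.1‖ * ‖x.2 - z • x.1‖ := by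
    calc |z.im| * ‖x.1‖ ^ 2 = |(inner ℂ x.1 (x.2 - z • x.1) : ℂ).im| := by
          rw [h2, abs_neg, abs_mul, abs_of_nonneg (sq_nonneg ‖x.1‖)]
      _ ≤ ‖(inner ℂ x.1 (x.2 - z • x.1) : ℂ)‖ := Complex.abs_im_le_norm _
      _ ≤ _ := norm_inner_le_norm _ _
  rcases (norm_nonneg x.1).eq_or_lt with h0 | h0
  · rw [← h0, mul_zero]; exact norm_nonneg _
  · nlinarith

/-- A self-adjoint relation has all non-real numbers in its resolvent set: `S - z` is onto. -/
lemma IsSelfAdjoint.exists_sub_smul_eq [CompleteSpace E] {S : Submodule ℂ (E × E)}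
    (hS : IsSelfAdjoint S) {z : ℂ} (hz : z.im ≠ 0) (h : E) :
    ∃ x ∈ S, x.2 - z • x.1 = h := by
  have hz' : 0 < |z.im| := abs_pos.2 hz
  let L : S →L[ℂ] E := (ContinuousLinearMap.snd ℂ E E - z • ContinuousLinearMap.fst ℂ E E) ∘L
    S.subtypeL
  have hL : ∀ x : S, L x = x.1.2 - z • x.1.1 := fun x => rfl
  have : CompleteSpace S := hS.isClosed.completeSpace_coe
  have hanti : AntilipschitzWith (Real.toNNReal (1 + (1 + ‖z‖) / |z.im|)) L := by
    refine L.antilipschitz_of_bound fun x => ?_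
    rw [Real.coe_toNNReal _ (by positivity), hL]
    have h1 := hS.isSymmetric.abs_im_mul_norm_le z x.2
    have h2 : ‖x.1.1‖ ≤ ‖x.1.2 - z • x.1.1‖ / |z.im| := by
      rw [le_div_iff₀ hz']; linarith
    have h3 : ‖x.1.2‖ ≤ ‖x.1.2 - z • x.1.1‖ + ‖z‖ * ‖x.1.1‖ := by
      rw [← norm_smul]; exact norm_le_norm_sub_add _ _
    have h4 : ‖x‖ ≤ ‖x.1.1‖ + ‖x.1.2‖ := by
      change ‖x.1‖ ≤ _
      rw [Prod.norm_def]
      exact max_le (by linarith [norm_nonneg x.1.2]) (by linarith [norm_nonneg x.1.1])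
    calc ‖x‖ ≤ ‖x.1.2 - z • x.1.1‖ + (1 + ‖z‖) * ‖x.1.1‖ := by linarith
      _ ≤ ‖x.1.2 - z • x.1.1‖ + (1 + ‖z‖) * (‖x.1.2 - z • x.1.1‖ / |z.im|) := by gcongr
      _ = _ := by ring
  have hcl : IsClosed (L.range : Set E) := by
    rw [LinearMap.coe_range]
    exact hanti.isClosed_range L.uniformContinuous
  have : CompleteSpace L.range := hcl.completeSpace_coe
  have htop : L.range = ⊤ := by
    rw [← Submodule.orthogonal_eq_bot_iff, Submodule.eq_bot_iff]
    intro g hg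
    have hmem : (g, (starRingEnd ℂ z) • g) ∈ S := hS.mem_of_inner_eq fun a b hab => by
      have := (Submodule.mem_orthogonal _ _).1 hg _ ⟨⟨(a, b), hab⟩, rfl⟩
      change inner ℂ (b - z • a) g = 0 at this
      rw [inner_sub_left, inner_smul_left] at this
      rw [inner_smul_right, sub_eq_zero.1 this]
    have := hS.isSymmetric.abs_im_mul_norm_le (starRingEnd ℂ z) hmem
    simp only [sub_self, norm_zero, Complex.conj_im, abs_neg] at this
    exact norm_le_zero_iff.1 (nonpos_of_mul_nonpos_right this hz')
  obtain ⟨x, hx⟩ : h ∈ L.range := htop ▸ Submodule.mem_top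
  exact ⟨x.1, x.2, hx⟩

/-- A symmetric relation `S` such that `S - z` is onto for some `z` in each of the two open
half-planes is self-adjoint. The two numbers need not be conjugate to each other: each range
condition gives `S* = S + {(n, z n) ∈ S*}`, so that the form `Im (g', g)` on `S*`, which does not
see `S`, is nonnegative for one of them and nonpositive for the other. -/
lemma IsSymmetric.isSelfAdjoint {S : Submodule ℂ (E × E)} (hS : IsSymmetric S) {zp zm : ℂ}
    (hzp : 0 < zp.im) (hzm : zm.im < 0) (hp : ∀ h, ∃ x ∈ S, x.2 - zp • x.1 = h)
    (hm : ∀ h, ∃ x ∈ S, x.2 - zm • x.1 = h) : IsSelfAdjoint S := by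
  -- the form `Im (g', g)` is computed on the defect component
  have key : ∀ (z : ℂ), (∀ h, ∃ x ∈ S, x.2 - z • x.1 = h) → ∀ g ∈ S.adjoint,
      ∃ x ∈ S, g.2 - x.2 = z • (g.1 - x.1) ∧
        (inner ℂ g.1 g.2 : ℂ).im = z.im * ‖g.1 - x.1‖ ^ 2 := by
    intro z hz g hg
    obtain ⟨x, hx, hxe⟩ := hz (g.2 - z • g.1)
    have hn : g.2 - x.2 = z • (g.1 - x.1) := by
      rw [smul_sub, sub_eq_sub_iff_sub_eq_sub, ← hxe]
    refine ⟨x, hx, hn, ?_⟩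
    have hxx : inner ℂ x.2 x.1 = inner ℂ x.1 x.2 := hS.inner_eq hx hx
    have hxg : inner ℂ x.2 g.1 = inner ℂ x.1 g.2 :=
      sub_eq_zero.1 ((Submodule.mem_adjoint_iff _ _).1 hg x.1 x.2 hx)
    have h1 : (inner ℂ (g.1 - x.1) (g.2 - x.2) : ℂ).im = z.im * ‖g.1 - x.1‖ ^ 2 := by
      rw [hn, im_inner_smul_self]
    rw [← h1, inner_sub_left, inner_sub_right, inner_sub_right]
    have e1 : (inner ℂ x.1 x.2 : ℂ).im = 0 := by
      rw [← inner_conj_symm] at hxx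
      exact Complex.conj_eq_iff_im.1 hxx
    have e2 : (inner ℂ g.1 x.2 : ℂ).im = -(inner ℂ x.1 g.2 : ℂ).im := by
      rw [← hxg, ← inner_conj_symm, Complex.conj_im]
    simp only [Complex.sub_im, e1, e2]
    ring
  refine le_antisymm hS fun g hg => ?_
  obtain ⟨x, hx, hn, hgx⟩ := key zp hp g hg
  obtain ⟨y, -, -, hgy⟩ := key zm hm g hg
  have h0 : zp.im * ‖g.1 - x.1‖ ^ 2 ≤ 0 := by
    rw [← hgx, hgy]
    exact mul_nonpos_of_nonpos_of_nonneg hzm.le (sq_nonneg _)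
  have h1 : g.1 - x.1 = 0 := by
    have := nonpos_of_mul_nonpos_right h0 hzp
    exact norm_eq_zero.1 (pow_eq_zero_iff two_ne_zero |>.1 (le_antisymm this (sq_nonneg _)))
  have h2 : g = x := by
    rw [h1, smul_zero] at hn
    exact Prod.ext (sub_eq_zero.1 h1) (sub_eq_zero.1 hn)
  rwa [h2]

end SelfAdjoint

/-! ### The Fredholm alternative for self-adjoint relations -/

section FredholmAlternative

variable {E : Type*} [NormedAddCommGroup E] [InnerProductSpace ℂ E]

lemma subScalar_zero (S : Submodule ℂ (E × E)) : subScalar S 0 = S := by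
  ext x
  simp [subScalar]

lemma mem_opSpace {S : Submodule ℂ (E × E)} {x y : E} (h : (x, y) ∈ S) : x ∈ opSpace S :=
  Submodule.le_topologicalClosure _ ⟨(x, y), h, rfl⟩

lemma IsSelfAdjoint.zero_mem_of_mem_orthogonal {S : Submodule ℂ (E × E)} (hS : IsSelfAdjoint S)
    {y : E} (hy : y ∈ (opSpace S)ᗮ) : (0, y) ∈ S :=
  hS.mem_of_inner_eq fun a b hab => by
    rw [inner_zero_right, (Submodule.mem_orthogonal _ _).1 hy a (mem_opSpace hab)]

variable {S : Submodule ℂ (E × E)}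

lemma finiteDimensional_ker_of_isFredholm_opPart (h : IsFredholm (opPart S)) :
    FiniteDimensional ℂ (ker S) := by
  have heq : ker S = (ker (opPart S)).map (opSpace S).subtype := by
    ext x
    constructor
    · exact fun hx => ⟨⟨x, mem_opSpace hx⟩, hx, rfl⟩
    · rintro ⟨y, hy, rfl⟩
      exact hy
  have := h.finiteDimensional_ker
  rw [heq]
  infer_instance

variable [CompleteSpace E]

/-- Since `{0} × (dom S)ᗮ ⊆ S`, a vector lies in `ran S` as soon as its component in the closure
of `dom S` lies in the range of the operator part. -/
lemma IsSelfAdjoint.isClosed_ran_of_isFredholm_opPart (hS : IsSelfAdjoint S)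
    (h : IsFredholm (opPart S)) : IsClosed (ran S : Set E) := by
  have heq : (ran S : Set E) =
      (opSpace S).orthogonalProjectionOnto ⁻¹' (ran (opPart S) : Set (opSpace S)) := by
    ext y
    have hy := hS.zero_mem_of_mem_orthogonal
      ((opSpace S).sub_starProjection_mem_orthogonal y)
    constructor
    · rintro ⟨⟨x, y'⟩, hx, rfl⟩
      refine ⟨(⟨x, mem_opSpace hx⟩, (opSpace S).orthogonalProjectionOnto y'), ?_, rfl⟩
      have hmem := S.sub_mem hx hy
      change (x, y') - (0, y' - (opSpace S).starProjection y') ∈ S at hmem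
      rw [Prod.mk_sub_mk, sub_zero, sub_sub_cancel] at hmem
      exact hmem
    · rintro ⟨⟨x, y'⟩, hx, hxy⟩
      have hxy' : (y' : E) = (opSpace S).starProjection y := congrArg Subtype.val hxy
      have hx' : ((x : E), (y' : E)) ∈ S := hx
      refine ⟨((x : E), y), ?_, rfl⟩
      have := S.add_mem hx' hy
      simpa [hxy'] using this
  rw [heq]
  exact h.isClosed_ran.preimage (by fun_prop)

/-- For a self-adjoint relation with closed range and finite-dimensional kernel, and `P` the
orthogonal projection onto the kernel, `S + P` is boundedly invertible. -/
lemma IsSelfAdjoint.exists_inverse_add_starProjection (hS : IsSelfAdjoint S)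
    [FiniteDimensional ℂ (ker S)] (hran : IsClosed (ran S : Set E)) :
    ∃ R : E →L[ℂ] E, ∀ ψ φ, (φ, ψ - (ker S).starProjection φ) ∈ S ↔ φ = R ψ := by
  set P := (ker S).starProjection with hP
  have hPk : ∀ x, (P x, (0 : E)) ∈ S := fun x => (ker S).starProjection_apply_mem x
  have hPP : ∀ x, P (P x) = P x := fun x =>
    (ker S).starProjection_eq_self_iff.2 (hPk x)
  -- by closedness, `ran S` is the whole orthogonal complement of the kernel
  have hort : ∀ x ∈ (ker S)ᗮ, x ∈ ran S := by
    intro x hx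
    have : CompleteSpace (ran S) := hran.completeSpace_coe
    rw [← (ran S).orthogonal_orthogonal]
    refine (Submodule.mem_orthogonal _ _).2 fun g hg => ?_
    have hgk : (g, (0 : E)) ∈ S := hS.mem_of_inner_eq fun a b hab => ?_
    · exact (Submodule.mem_orthogonal _ _).1 hx g hgk
    rw [inner_zero_right, (Submodule.mem_orthogonal _ _).1 hg b ⟨(a, b), hab, rfl⟩]
  let J : (E × E) →L[ℂ] E × E := (ContinuousLinearMap.snd ℂ E E).prod
    (ContinuousLinearMap.fst ℂ E E - P ∘L ContinuousLinearMap.snd ℂ E E)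
  refine exists_clm_of_isClosed (W := S.comap (J : (E × E) →ₗ[ℂ] E × E))
    (hS.isClosed.preimage J.continuous) fun ψ => ?_
  obtain ⟨⟨f, f'⟩, hf, hff⟩ := hort _ ((ker S).sub_starProjection_mem_orthogonal ψ)
  have hff' : f' = ψ - P ψ := hff
  -- `f` is corrected by a vector of `ker S` so that its component in `ker S` becomes `P ψ`
  refine ⟨f + P ψ - P f, ?_, fun φ hφ => ?_⟩
  · change (f + P ψ - P f, ψ - P (f + P ψ - P f)) ∈ S
    have := S.sub_mem (S.add_mem hf (hPk ψ)) (hPk f)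
    simpa [hPP, hff'] using this
  · change (φ, ψ - P φ) ∈ S at hφ
    set χ := φ - (f + P ψ - P f) with hχ
    have hmem : (χ, -P χ) ∈ S := by
      have := S.sub_mem hφ (S.sub_mem (S.add_mem hf (hPk ψ)) (hPk f))
      simpa [hχ, hPP, hff'] using this
    have h0 : P χ = 0 := by
      have := hS.isSymmetric.inner_eq hmem (hPk χ)
      simpa using this
    have hχk : χ ∈ ker S := by
      have : (χ, (0 : E)) ∈ S := by simpa [h0] using hmem
      exact this
    have : χ = 0 := by rw [← h0]; exact ((ker S).starProjection_eq_self_iff.2 hχk).symm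
    exact sub_eq_zero.1 this

/-- The Fredholm alternative for `S - K`, where `S` is a self-adjoint relation with
`0 ∉ σ_ess(S)` and `K` is compact: if `S - K` is injective, then it is onto. -/
lemma IsSelfAdjoint.exists_add_mem_of_isCompactOperator (hS : IsSelfAdjoint S)
    (h0 : (0 : ℝ) ∉ essSpectrum S) {K : E →L[ℂ] E} (hK : IsCompactOperator K)
    (hinj : ∀ φ, (φ, K φ) ∈ S → φ = 0) (ψ : E) : ∃ φ, (φ, ψ + K φ) ∈ S := by
  have hF : IsFredholm (opPart S) := by
    have := not_not.1 h0
    rwa [Complex.ofReal_zero, subScalar_zero] at this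
  have := finiteDimensional_ker_of_isFredholm_opPart hF
  obtain ⟨R, hR⟩ :=
    hS.exists_inverse_add_starProjection (hS.isClosed_ran_of_isFredholm_opPart hF)
  set P := (ker S).starProjection with hP
  have hPc : IsCompactOperator P :=
    (isCompactOperator_of_locallyCompactSpace_rng (ker S).subtypeL).comp_clm
      (ker S).orthogonalProjectionOnto
  -- `(φ, ψ + K φ) ∈ S` means that `φ - R (K + P) φ = R ψ`
  have hiff : ∀ ψ φ, (φ, ψ + K φ) ∈ S ↔ φ = R ψ + R (K φ + P φ) := by
    intro ψ φ
    rw [← map_add, ← hR]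
    have : ψ + (K φ + P φ) - P φ = ψ + K φ := by abel
    rw [this]
  have hcomp : IsCompactOperator (R ∘L (K + P)) := (hK.add hPc).clm_comp R
  rcases hcomp.hasEigenvalue_or_mem_resolventSet one_ne_zero with h | h
  · obtain ⟨φ, hφ⟩ := h.exists_hasEigenvector
    have h1 : R (K φ + P φ) = φ := by simpa using hφ.apply_eq_smul
    refine absurd (hinj φ ?_) hφ.2
    simpa using (hiff 0 φ).2 (by rw [map_zero, zero_add, h1])
  · rw [spectrum.mem_resolventSet_iff, ContinuousLinearMap.isUnit_iff_bijective] at h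
    obtain ⟨φ, hφ⟩ := h.2 (R ψ)
    refine ⟨φ, (hiff ψ φ).2 ?_⟩
    rw [← hφ]
    simp

end FredholmAlternative

end LinRel

/-! ### Quasi boundary triples: the `γ`-field, the Weyl function and `A_Θ` -/

namespace QuasiBoundaryTriple

variable {H : Type*} [NormedAddCommGroup H] [InnerProductSpace ℂ H] {A : Submodule ℂ (H × H)}
  {G : Type*} [NormedAddCommGroup G] [InnerProductSpace ℂ G] (Q : QuasiBoundaryTriple A G)

lemma mem_defect_iff {z : ℂ} {f : Q.T} : f ∈ Q.defect z ↔ (f : H × H).2 = z • (f : H × H).1 := by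
  simp [defect, LinearMap.mem_graph_iff]

lemma dense_G₀ : Dense (Q.G₀ : Set G) :=
  Prod.fst_surjective.denseRange.comp Q.dense_range continuous_fst

lemma green_defect {z w : ℂ} {n m : Q.T} (hn : n ∈ Q.defect z) (hm : m ∈ Q.defect w) :
    inner ℂ (Q.Γ₀ m) (Q.Γ₁ n) - inner ℂ (Q.Γ₁ m) (Q.Γ₀ n) =
      (z - starRingEnd ℂ w) * inner ℂ (m : H × H).1 (n : H × H).1 := by
  rw [← Q.green n m, Q.mem_defect_iff.1 hn, Q.mem_defect_iff.1 hm, inner_smul_right,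
    inner_smul_left]
  ring

lemma isSymmetric_ext {Θ : Submodule ℂ (G × G)} (hΘ : LinRel.IsSymmetric Θ) :
    LinRel.IsSymmetric (Q.ext Θ) := by
  rintro _ ⟨g, hg, rfl⟩
  rw [Submodule.mem_adjoint_iff]
  rintro a b ⟨f, hf, hab⟩
  have hΓ : inner ℂ (Q.Γ₁ f) (Q.Γ₀ g) = inner ℂ (Q.Γ₀ f) (Q.Γ₁ g) := hΘ.inner_eq hf hg
  have h := Q.green g f
  have hab' : (f : H × H) = (a, b) := hab
  rw [hab', hΓ, sub_self] at h
  change inner ℂ b (g : H × H).1 - inner ℂ a (g : H × H).2 = 0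
  rw [← neg_sub, h, neg_zero]

section Complete

variable [CompleteSpace H]

/-- If `ker Γ` is self-adjoint, then `ker Γ - z` is onto for non-real `z`. -/
lemma exists_mem_ker_sub_smul_eq {Γ : Q.T →ₗ[ℂ] G}
    (hΓ : LinRel.IsSelfAdjoint ((LinearMap.ker Γ).map Q.T.subtype)) {z : ℂ} (hz : z.im ≠ 0)
    (h : H) : ∃ f : Q.T, Γ f = 0 ∧ (f : H × H).2 - z • (f : H × H).1 = h := by
  obtain ⟨_, ⟨f, hf, rfl⟩, hfh⟩ := hΓ.exists_sub_smul_eq hz h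
  exact ⟨f, hf, hfh⟩

/-- The decomposition `T = ker Γ + N̂_z`: the map `Γ` attains all its values on `N̂_z`. -/
lemma exists_mem_defect_apply_eq {Γ : Q.T →ₗ[ℂ] G}
    (hΓ : LinRel.IsSelfAdjoint ((LinearMap.ker Γ).map Q.T.subtype)) {z : ℂ} (hz : z.im ≠ 0)
    (f : Q.T) : ∃ n ∈ Q.defect z, Γ n = Γ f := by
  obtain ⟨g, hg, hgf⟩ := Q.exists_mem_ker_sub_smul_eq hΓ hz
    ((f : H × H).2 - z • (f : H × H).1)
  refine ⟨f - g, Q.mem_defect_iff.2 ?_, by rw [map_sub, hg, sub_zero]⟩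
  change (f : H × H).2 - (g : H × H).2 = z • ((f : H × H).1 - (g : H × H).1)
  rw [smul_sub, sub_eq_sub_iff_sub_eq_sub, ← hgf]

/-- Since `Γ₀` maps `N̂_z` onto `𝒢₀`, an identity on `𝒢₀` may be checked on `Γ₀ N̂_z`. -/
lemma eqOn_G₀ {X : Type*} {z : ℂ} (hz : z.im ≠ 0) {u v : G → X}
    (h : ∀ n ∈ Q.defect z, u (Q.Γ₀ n) = v (Q.Γ₀ n)) : Set.EqOn u v Q.G₀ := by
  rintro _ ⟨f, rfl⟩
  obtain ⟨n, hn, hnf⟩ := Q.exists_mem_defect_apply_eq Q.isSelfAdjoint_ker hz f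
  rw [← hnf, h n hn]

lemma clm_ext {X : Type*} [NormedAddCommGroup X] [NormedSpace ℂ X] {z : ℂ} (hz : z.im ≠ 0)
    {u v : G →L[ℂ] X} (h : ∀ n ∈ Q.defect z, u (Q.Γ₀ n) = v (Q.Γ₀ n)) : u = v :=
  ContinuousLinearMap.coeFn_injective
    (Continuous.ext_on Q.dense_G₀ u.continuous v.continuous (Q.eqOn_G₀ hz h))

lemma ext_inner_Γ₀ {z : ℂ} (hz : z.im ≠ 0) {x y : G}
    (h : ∀ n ∈ Q.defect z, inner ℂ (Q.Γ₀ n) x = inner ℂ (Q.Γ₀ n) y) : x = y :=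
  Q.dense_G₀.eq_of_inner_right ℂ fun _ hv =>
    Q.eqOn_G₀ hz (u := fun g => inner ℂ g x) (v := fun g => inner ℂ g y) h hv

lemma apply_mem_ran_closure_weyl {z : ℂ} (hz : z.im ≠ 0) {K : G →L[ℂ] G}
    (hKΓ : ∀ n ∈ Q.defect z, K (Q.Γ₀ n) = Q.Γ₁ n) (φ : G) :
    K φ ∈ LinRel.ran (Q.weyl z).topologicalClosure := by
  refine ⟨(φ, K φ), ?_, rfl⟩
  refine map_mem_closure (f := fun x => (x, K x)) (by fun_prop) (Q.dense_G₀ φ) ?_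
  rintro _ ⟨f, rfl⟩
  obtain ⟨n, hn, hnf⟩ := Q.exists_mem_defect_apply_eq Q.isSelfAdjoint_ker hz f
  refine ⟨n, hn, ?_⟩
  change (Q.Γ₀ n, Q.Γ₁ n) = (Q.Γ₀ f, K (Q.Γ₀ f))
  rw [← hnf, hKΓ n hn]

variable [CompleteSpace G]

/-- The `γ`-field is bounded: the map `Γ₀ n ↦ f` for `n = (f, z f) ∈ N̂_z` extends to a bounded
operator. It is obtained as the adjoint of the map `h ↦ Γ₁ f̂`, where `f̂ = (f, f') ∈ ker Γ₀` with
`f' - z̄ f = h`, which is everywhere defined and has a closed graph. -/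
lemma exists_gammaField {z : ℂ} (hz : z.im ≠ 0) :
    ∃ γ : G →L[ℂ] H, ∀ n ∈ Q.defect z, γ (Q.Γ₀ n) = (n : H × H).1 := by
  let W : Submodule ℂ (H × G) := ⨅ n ∈ Q.defect z,
    ((innerSL ℂ (Q.Γ₀ n)).comp (ContinuousLinearMap.snd ℂ H G) -
      (innerSL ℂ (n : H × H).1).comp (ContinuousLinearMap.fst ℂ H G) : H × G →L[ℂ] ℂ).ker
  have hmem : ∀ h y, (h, y) ∈ W ↔
      ∀ n ∈ Q.defect z, inner ℂ (Q.Γ₀ n) y = inner ℂ (n : H × H).1 h := by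
    intro h y
    simp [W, Submodule.mem_iInf, sub_eq_zero]
  have hW : IsClosed (W : Set (H × G)) := by
    simp only [W, Submodule.coe_iInf]
    exact isClosed_biInter fun n _ => ContinuousLinearMap.isClosed_ker _
  obtain ⟨D, hD⟩ := LinRel.exists_clm_of_isClosed hW fun h => by
    obtain ⟨f, hf, hfh⟩ := Q.exists_mem_ker_sub_smul_eq Q.isSelfAdjoint_ker
      (z := starRingEnd ℂ z) (by simpa using hz) h
    have hfW : (h, Q.Γ₁ f) ∈ W := by
      refine (hmem _ _).2 fun n hn => ?_
      have hg := Q.green f n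
      rw [hf, inner_zero_right, sub_zero, Q.mem_defect_iff.1 hn, inner_smul_left] at hg
      rw [← hg, ← hfh, inner_sub_right, inner_smul_right]
    exact ⟨_, hfW, fun y hy => Q.ext_inner_Γ₀ hz fun n hn =>
      ((hmem _ _).1 hy n hn).trans ((hmem _ _).1 hfW n hn).symm⟩
  refine ⟨D.adjoint, fun n hn => ext_inner_right ℂ fun h => ?_⟩
  rw [ContinuousLinearMap.adjoint_inner_left]
  exact (hmem _ _).1 ((hD h _).2 rfl) n hn

/-- If `M(z₀)` has a compact extension, then so has `M(z)` for every non-real `z`. Compactness of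
`γ(z₀)` comes from `K - K* = (z₀ - z̄₀) γ(z₀)* γ(z₀)`, and it passes to `M(z)` through
`M(z) ⊆ K* + (z - z̄₀) γ(z₀)* γ(z)`. -/
lemma exists_isCompactOperator_weyl {z₀ : ℂ} (hz₀ : z₀.im ≠ 0) {K : G →L[ℂ] G}
    (hK : IsCompactOperator K) (hKΓ : ∀ n ∈ Q.defect z₀, K (Q.Γ₀ n) = Q.Γ₁ n)
    {z : ℂ} (hz : z.im ≠ 0) :
    ∃ L : G →L[ℂ] G, IsCompactOperator L ∧ ∀ n ∈ Q.defect z, L (Q.Γ₀ n) = Q.Γ₁ n := by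
  obtain ⟨γ₀, hγ₀⟩ := Q.exists_gammaField hz₀
  obtain ⟨γ, hγ⟩ := Q.exists_gammaField hz
  have hKadj := LinRel.isCompactOperator_adjoint hK
  have hformula : ∀ {w : ℂ} {δ : G →L[ℂ] H}, (∀ n ∈ Q.defect w, δ (Q.Γ₀ n) = (n : H × H).1) →
      ∀ n ∈ Q.defect w, (K.adjoint + (w - starRingEnd ℂ z₀) • (γ₀.adjoint ∘L δ)) (Q.Γ₀ n) =
        Q.Γ₁ n := by
    intro w δ hδ n hn
    refine Q.ext_inner_Γ₀ hz₀ fun m hm => ?_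
    have h := Q.green_defect hn hm
    simp only [add_apply, smul_apply, ContinuousLinearMap.comp_apply, inner_add_right,
      inner_smul_right, ContinuousLinearMap.adjoint_inner_right, hδ n hn, hγ₀ m hm, hKΓ m hm]
    rw [← h]
    ring
  have hz₀' : z₀ - starRingEnd ℂ z₀ ≠ 0 := fun h =>
    hz₀ (Complex.conj_eq_iff_im.1 (sub_eq_zero.1 h).symm)
  have hγ₀c : IsCompactOperator γ₀ := by
    have heq : K = K.adjoint + (z₀ - starRingEnd ℂ z₀) • (γ₀.adjoint ∘L γ₀) :=
      Q.clm_ext hz₀ fun n hn => (hKΓ n hn).trans (hformula hγ₀ n hn).symm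
    refine LinRel.isCompactOperator_of_adjoint_comp ?_
    have heq' : γ₀.adjoint ∘L γ₀ = (z₀ - starRingEnd ℂ z₀)⁻¹ • (K - K.adjoint) := by
      rw [eq_inv_smul_iff₀ hz₀', eq_sub_iff_add_eq', ← heq]
    rw [heq']
    exact (hK.sub hKadj).smul _
  exact ⟨_, hKadj.add (((LinRel.isCompactOperator_adjoint hγ₀c).comp_clm γ).smul _), hformula hγ⟩

/-- `A_Θ - z` is onto. With `f̂ ∈ ker Γ₀` solving `f' - z f = h`, the element `f̂ + n`, `n ∈ N̂_z`,
belongs to `A_Θ` if and only if `φ = Γ₀ n` satisfies `(φ, Γ₁ f̂ + M(z) φ) ∈ Θ`. -/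
lemma exists_mem_ext_sub_smul_eq (hA₁ : LinRel.IsSelfAdjoint Q.A₁) {Θ : Submodule ℂ (G × G)}
    (hΘ : LinRel.IsSelfAdjoint Θ) (h0 : (0 : ℝ) ∉ LinRel.essSpectrum Θ) {z : ℂ} (hz : z.im ≠ 0)
    {K : G →L[ℂ] G} (hK : IsCompactOperator K) (hKΓ : ∀ n ∈ Q.defect z, K (Q.Γ₀ n) = Q.Γ₁ n)
    (hpre : LinRel.preimage Θ (LinRel.ran (Q.weyl z).topologicalClosure) ⊆ Q.G₀) (h : H) :
    ∃ x ∈ Q.ext Θ, x.2 - z • x.1 = h := by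
  have hsolve : ∀ φ χ, (φ, K χ) ∈ Θ → ∃ n ∈ Q.defect z, Q.Γ₀ n = φ := by
    intro φ χ hφ
    obtain ⟨f, rfl⟩ := hpre ⟨K χ, Q.apply_mem_ran_closure_weyl hz hKΓ χ, hφ⟩
    exact Q.exists_mem_defect_apply_eq Q.isSelfAdjoint_ker hz f
  have hinj : ∀ φ, (φ, K φ) ∈ Θ → φ = 0 := by
    intro φ hφ
    obtain ⟨n, hn, rfl⟩ := hsolve φ φ hφ
    rw [hKΓ n hn] at hφ
    -- `n` belongs to the symmetric relation `A_Θ` and to the defect space at a non-real point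
    have hle := (Q.isSymmetric_ext hΘ.isSymmetric).abs_im_mul_norm_le z
      (x := (n : H × H)) ⟨n, hφ, rfl⟩
    have hn2 := Q.mem_defect_iff.1 hn
    rw [hn2, sub_self, norm_zero] at hle
    have hn1 : (n : H × H).1 = 0 :=
      norm_le_zero_iff.1 (nonpos_of_mul_nonpos_right hle (abs_pos.2 hz))
    have hn0 : n = 0 := Subtype.ext (Prod.ext hn1 (by rw [hn2, hn1, smul_zero]; rfl))
    rw [hn0, map_zero]
  obtain ⟨f, hf, hfh⟩ := Q.exists_mem_ker_sub_smul_eq Q.isSelfAdjoint_ker hz h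
  obtain ⟨φ, hφ⟩ := hΘ.exists_add_mem_of_isCompactOperator h0 hK hinj (Q.Γ₁ f)
  -- self-adjointness of `ker Γ₁` puts `Γ₁ f` into the range of `M(z)`
  obtain ⟨m, hm, hmf⟩ := Q.exists_mem_defect_apply_eq hA₁ hz f
  obtain ⟨n, hn, rfl⟩ := hsolve φ (Q.Γ₀ m + φ) (by rwa [map_add, hKΓ m hm, hmf])
  rw [hKΓ n hn] at hφ
  refine ⟨((f + n : Q.T) : H × H), ⟨f + n, ?_, rfl⟩, ?_⟩
  · change (Q.Γ₀ (f + n), Q.Γ₁ (f + n)) ∈ Θ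
    rwa [map_add, map_add, hf, zero_add]
  · change (f : H × H).2 + (n : H × H).2 - z • ((f : H × H).1 + (n : H × H).1) = h
    rw [Q.mem_defect_iff.1 hn, smul_add, add_sub_add_right_eq_sub, hfh]

end Complete

end QuasiBoundaryTriple
theorem mainTheorem5
    {H : Type*} [NormedAddCommGroup H] [InnerProductSpace ℂ H] [CompleteSpace H]
    {G : Type*} [NormedAddCommGroup G] [InnerProductSpace ℂ G] [CompleteSpace G]
    (A : Submodule ℂ (H × H)) (hA_closed : IsClosed (A : Set (H × H)))
    (hA_symm : LinRel.IsSymmetric A)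
    (Q : QuasiBoundaryTriple A G)
    (hA₁ : LinRel.IsSelfAdjoint Q.A₁)
    (hM : ∃ z₀ : ℂ, z₀.im ≠ 0 ∧ LinRel.IsCompactOp (Q.weyl z₀).topologicalClosure)
    (Θ : Submodule ℂ (G × G)) (hΘ : LinRel.IsSelfAdjoint Θ) :
    ((0 : ℝ) ∉ LinRel.essSpectrum Θ →
      (∃ zp zm : ℂ, 0 < zp.im ∧ zm.im < 0 ∧
        LinRel.preimage Θ (LinRel.ran (Q.weyl zp).topologicalClosure) ⊆ Q.G₀ ∧
        LinRel.preimage Θ (LinRel.ran (Q.weyl zm).topologicalClosure) ⊆ Q.G₀) →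
      LinRel.IsSelfAdjoint (Q.ext Θ)) ∧
    (LinRel.dom Θ ≤ Q.G₀ →
      ∀ zp zm : ℂ, 0 < zp.im → zm.im < 0 →
        LinRel.preimage Θ (LinRel.ran (Q.weyl zp).topologicalClosure) ⊆ Q.G₀ ∧
        LinRel.preimage Θ (LinRel.ran (Q.weyl zm).topologicalClosure) ⊆ Q.G₀) := by

  refine ⟨fun h0 ⟨zp, zm, hzp, hzm, hp, hm⟩ => ?_, fun hdom zp zm _ _ => ?_⟩
  · obtain ⟨z₀, hz₀, K, hK, hgraph⟩ := hM
    have hKΓ : ∀ n ∈ Q.defect z₀, K (Q.Γ₀ n) = Q.Γ₁ n := by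
      intro n hn
      have hmem : (Q.Γ₀ n, Q.Γ₁ n) ∈ (Q.weyl z₀).topologicalClosure :=
        Submodule.le_topologicalClosure _ ⟨n, hn, rfl⟩
      rw [hgraph, LinearMap.mem_graph_iff] at hmem
      exact hmem.symm
    obtain ⟨Kp, hKp, hKpΓ⟩ := Q.exists_isCompactOperator_weyl hz₀ hK hKΓ hzp.ne'
    obtain ⟨Km, hKm, hKmΓ⟩ := Q.exists_isCompactOperator_weyl hz₀ hK hKΓ hzm.ne
    exact (Q.isSymmetric_ext hΘ.isSymmetric).isSelfAdjoint hzp hzm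
      (Q.exists_mem_ext_sub_smul_eq hA₁ hΘ h0 hzp.ne' hKp hKpΓ hp)
      (Q.exists_mem_ext_sub_smul_eq hA₁ hΘ h0 hzm.ne hKm hKmΓ hm)
  · have hsub : ∀ X : Set G, LinRel.preimage Θ X ⊆ Q.G₀ := by
      rintro X x ⟨y, -, hxy⟩
      exact hdom ⟨(x, y), hxy, rfl⟩
    exact ⟨hsub _, hsub _⟩
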